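/- Let $\mathbb F$ be a field and let $q\in\mathbb F$ be nonzero with $q^4\neq 1$. Let $\Delta=\Delta_q$ be the associative unital $\mathbb F$-algebra defined by generators $A,B,C$ and the relations asserting that each of $$A+\frac{qBC-q^{-1}CB}{q^2-q^{-2}},\qquad B+\frac{qCA-q^{-1}AC}{q^2-q^{-2}},\qquad C+\frac{qAB-q^{-1}BA}{q^2-q^{-2}}$$ is central in $\Delta$. Let $\alpha,\beta,\gamma$ denote these three central elements, respectively, each multiplied by $q+q^{-1}$, and put $$\Omega=qABC+q^2A^2+q^{-2}B^2+q^2C^2-qA\alpha-q^{-1}B\beta-qC\gamma .$$ Then the elements $$A^iB^jC^k\Omega^\ell\alpha^r\beta^s\gamma^t,\qquad i,j,k,\ell,r,s,t\in\mathbb Z_{\ge 0},\quad ijk=0,$$ form a basis of the $\mathbb F$-vector space $\Delta$; that is, the family they form, indexed by the tuples $(i,j,k,\ell,r,s,t)$, is linearly independent and spans $\Delta$. -/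

import Mathlib

namespace UniversalAskeyWilson

/-- The three generating symbols. -/
inductive Gen : Type
  | A
  | B
  | C

/-- The expression `X + (q Y Z - q⁻¹ Z Y) / (q² - q⁻²)` in an algebra over the field `F`. -/
def centralExpr {F R : Type*} [Field F] [Ring R] [Algebra F R] (q : F) (X Y Z : R) : R :=
  X + (q ^ 2 - q⁻¹ ^ 2)⁻¹ • (q • (Y * Z) - q⁻¹ • (Z * Y))

/-- The defining relations, on the free algebra on the symbols `A`, `B`, `C`: each of
`A + (q B C - q⁻¹ C B) / (q² - q⁻²)`, `B + (q C A - q⁻¹ A C) / (q² - q⁻²)`,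
`C + (q A B - q⁻¹ B A) / (q² - q⁻²)` commutes with everything. -/
inductive Rel (F : Type*) [Field F] (q : F) :
    FreeAlgebra F Gen → FreeAlgebra F Gen → Prop
  | alpha (x : FreeAlgebra F Gen) : Rel F q
      (centralExpr q (FreeAlgebra.ι F Gen.A) (FreeAlgebra.ι F Gen.B) (FreeAlgebra.ι F Gen.C) * x)
      (x * centralExpr q (FreeAlgebra.ι F Gen.A) (FreeAlgebra.ι F Gen.B) (FreeAlgebra.ι F Gen.C))
  | beta (x : FreeAlgebra F Gen) : Rel F q
      (centralExpr q (FreeAlgebra.ι F Gen.B) (FreeAlgebra.ι F Gen.C) (FreeAlgebra.ι F Gen.A) * x)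
      (x * centralExpr q (FreeAlgebra.ι F Gen.B) (FreeAlgebra.ι F Gen.C) (FreeAlgebra.ι F Gen.A))
  | gamma (x : FreeAlgebra F Gen) : Rel F q
      (centralExpr q (FreeAlgebra.ι F Gen.C) (FreeAlgebra.ι F Gen.A) (FreeAlgebra.ι F Gen.B) * x)
      (x * centralExpr q (FreeAlgebra.ι F Gen.C) (FreeAlgebra.ι F Gen.A) (FreeAlgebra.ι F Gen.B))

/-- The universal Askey-Wilson algebra `Δ_q` over the field `F`: the associative unital
`F`-algebra presented by the generators `A`, `B`, `C` and the relations `Rel F q`. -/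
abbrev Delta (F : Type*) [Field F] (q : F) : Type _ := RingQuot (Rel F q)

section Elements

variable {F : Type*} [Field F] (q : F)

/-- The generator of `Δ` that comes from a symbol. -/
noncomputable def gen (g : Gen) : Delta F q :=
  RingQuot.mkAlgHom F (Rel F q) (FreeAlgebra.ι F g)

/-- The generator `A` of `Δ`. -/
noncomputable def A : Delta F q := gen q Gen.A

/-- The generator `B` of `Δ`. -/
noncomputable def B : Delta F q := gen q Gen.B

/-- The generator `C` of `Δ`. -/
noncomputable def C : Delta F q := gen q Gen.C

/-- `α = (q + q⁻¹) (A + (q B C - q⁻¹ C B) / (q² - q⁻²))`. -/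
noncomputable def α : Delta F q := (q + q⁻¹) • centralExpr q (A q) (B q) (C q)

/-- `β = (q + q⁻¹) (B + (q C A - q⁻¹ A C) / (q² - q⁻²))`. -/
noncomputable def β : Delta F q := (q + q⁻¹) • centralExpr q (B q) (C q) (A q)

/-- `γ = (q + q⁻¹) (C + (q A B - q⁻¹ B A) / (q² - q⁻²))`. -/
noncomputable def γ : Delta F q := (q + q⁻¹) • centralExpr q (C q) (A q) (B q)

/-- The Casimir element
`Ω = q A B C + q² A² + q⁻² B² + q² C² - q A α - q⁻¹ B β - q C γ`. -/
noncomputable def Ω : Delta F q :=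
  q • (A q * B q * C q) + q ^ 2 • A q ^ 2 + q⁻¹ ^ 2 • B q ^ 2 + q ^ 2 • C q ^ 2
    - q • (A q * α q) - q⁻¹ • (B q * β q) - q • (C q * γ q)

/-- The element `A^i B^j C^k Ω^ℓ α^r β^s γ^t` of `Δ`. -/
noncomputable def monomial (i j k l r s t : ℕ) : Delta F q :=
  A q ^ i * B q ^ j * C q ^ k * Ω q ^ l * α q ^ r * β q ^ s * γ q ^ t

end Elements

/-- The 7-tuples `(i, j, k, ℓ, r, s, t)` of nonnegative integers with `i j k = 0`. -/
@[ext]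
structure Index : Type where
  i : ℕ
  j : ℕ
  k : ℕ
  l : ℕ
  r : ℕ
  s : ℕ
  t : ℕ
  ijk_eq_zero : i * j * k = 0

end UniversalAskeyWilson

namespace UniversalAskeyWilson

/-! Independence comes from comparing leading terms in a quantum torus, spanning from a filtration
by degree.

For independence, `realization` maps `Δ` to operators generated by invertible `X`, `K` with `K X =
q² X K` and central invertible `b`, `g`, `f`, `m`. Give `X`, `b`, `g`, `f` the weights 2, 3, 1, 4
and `K`, `m` the weight 0. Then one monomial strictly dominates in each image: `X`, `K b`, `X⁻¹ K⁻¹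
f` for `A`, `B`, `C`, and `b f`, `b m`, `g`, `f` for `Ω`, `α`, `β`, `γ`. Up to multiples, the only
linear relation among these seven exponents is that those of `A`, `B`, `C` add up to that of `Ω`.
The condition `ijk = 0` excludes it, so the family has pairwise distinct leading exponents
(`leadingExpo_injective`) and `linearIndependent_of_hasLeading` applies.

For spanning, let `A`, `B`, `C` have degree 1 and `α`, `β`, `γ` degree 0. Modulo lower degree the
generators commute up to the scalars `q^{±2}` (`sub_smul_mem_filt`), and `q A B C` agrees with `Ω`
(`mul_mul_multipleMod_Ω`). Ordered monomials with `i`, `j`, `k` all positive can thus trade `A B C`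
for `Ω` (`monomial_succ_multipleMod`), and induction on the degree finishes
(`filt_le_monomialSpan`). Centrality of `Ω` is never needed. -/

/-- Exponents of the monomials `X^x K^k b^c g^p f^y m^z` in a quantum torus of rank two over the
Laurent polynomials in four central variables. -/
abbrev Expo : Type := ℤ × ℤ × ℤ × ℤ × ℤ × ℤ

/-! ### The quantum torus as an algebra of operators. -/

section Torus

variable {F V : Type*} [Field F] [AddCommGroup V] [Module F V] {q : F} {b : Module.Basis Expo F V}

/-- The monomial operator with exponent `u` on a space with basis `b` indexed by `Expo`; the
variables satisfy `K X = q² X K`. -/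
noncomputable def torus (b : Module.Basis Expo F V) (q : F) (u : Expo) : Module.End F V :=
  b.constr F fun g => q ^ (2 * (u.2.1 * g.1)) • b (u + g)

theorem torus_apply (u g : Expo) : torus b q u (b g) = q ^ (2 * (u.2.1 * g.1)) • b (u + g) := by
  simp [torus]

theorem torus_mul (hq : q ≠ 0) (u v : Expo) :
    torus b q u * torus b q v = q ^ (2 * (u.2.1 * v.1)) • torus b q (u + v) := by
  refine b.ext fun g => ?_
  simp only [Module.End.mul_apply, torus_apply, map_smul, LinearMap.smul_apply, smul_smul,
    ← zpow_add₀ hq, add_assoc, Prod.fst_add, Prod.snd_add]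
  congr 2
  ring

theorem torus_zero : torus b q 0 = 1 := by
  refine b.ext fun g => ?_
  simp [torus_apply]

end Torus

/-! ### Images of the generators and of the central elements. -/

section Realization

variable {F R : Type*} [Field F] [Ring R] [Algebra F R] {q : F} {T : Expo → R}

/-- The image of the generator `A`. -/
def opA (T : Expo → R) : R :=
  T (1, 0, 0, 0, 0, 0) + T (0, 1, 0, 0, 0, 0) + T (0, -1, 0, 0, 0, 0)

/-- The image of the generator `B`. -/
def opB (q : F) (T : Expo → R) : R :=
  T (0, 1, 1, 0, 0, 0) + T (0, -1, -1, 0, 0, 0)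
    + q⁻¹ ^ 2 • T (-1, 2, 1, 0, 0, 0) - q⁻¹ • T (-1, 1, 0, 1, 0, 0)
    + T (-1, 0, 0, 0, 1, 0) - q • T (-1, -1, 0, 0, 0, 1)
    + q ^ 2 • T (-1, -2, -1, 0, 0, 0)

/-- The image of the generator `C`. -/
def opC (q : F) (T : Expo → R) : R :=
  (-q) • T (-1, -1, 0, 0, 1, 0) - q⁻¹ • T (1, -1, -1, 0, 0, 0)
    - q⁻¹ • T (-1, 1, 1, 0, 0, 0) + T (-1, 0, 0, 1, 0, 0)
    + q ^ 2 • T (-1, -2, 0, 0, 0, 1) - q ^ 3 • T (-1, -3, -1, 0, 0, 0)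
    + T (0, -1, 0, 0, 0, 1) - (q + q⁻¹) • T (0, -2, -1, 0, 0, 0)

/-- The image of `α`. -/
def opα (T : Expo → R) : R :=
  T (0, 0, 1, 0, 0, 1) + T (0, 0, -1, 1, 0, 0)

/-- The image of `β`. -/
def opβ (T : Expo → R) : R :=
  T (0, 0, 0, 1, 0, 0) + T (0, 0, 0, 0, 0, 1)

/-- The image of `γ`. -/
def opγ (T : Expo → R) : R :=
  T (0, 0, 0, 0, 1, 0) + T (0, 0, 1, 0, 0, 0) + T (0, 0, -1, 0, 0, 0)

/-- This identity and the next two are the defining relations for the images, with the central part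
made explicit. Only the multiplication law of `T` enters, so each is a comparison of coefficients.
-/
theorem q_mul_opA_opB (hq : q ≠ 0)
    (hT : ∀ u v, T u * T v = q ^ (2 * (u.2.1 * v.1)) • T (u + v)) :
    q • (opA T * opB q T) - q⁻¹ • (opB q T * opA T) =
      (q - q⁻¹) • opγ T - (q ^ 2 - q⁻¹ ^ 2) • opC q T := by
  simp only [opA, opB, opC, opγ, mul_add, add_mul, mul_sub, sub_mul, smul_mul_assoc, mul_smul_comm,
    hT, Prod.mk_add_mk, smul_add, smul_sub, smul_smul]
  -- Adding up the exponents makes equal monomials syntactically equal, so that coefficients can be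
  -- matched.
  norm_num
  match_scalars <;> field_simp <;> ring

theorem q_mul_opC_opA (hq : q ≠ 0)
    (hT : ∀ u v, T u * T v = q ^ (2 * (u.2.1 * v.1)) • T (u + v)) :
    q • (opC q T * opA T) - q⁻¹ • (opA T * opC q T) =
      (q - q⁻¹) • opβ T - (q ^ 2 - q⁻¹ ^ 2) • opB q T := by
  simp only [opA, opB, opC, opβ, mul_add, add_mul, mul_sub, sub_mul, smul_mul_assoc, mul_smul_comm,
    hT, Prod.mk_add_mk, smul_add, smul_sub, smul_smul]
  norm_num
  match_scalars <;> field_simp <;> ring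

theorem q_mul_opB_opC (hq : q ≠ 0)
    (hT : ∀ u v, T u * T v = q ^ (2 * (u.2.1 * v.1)) • T (u + v)) :
    q • (opB q T * opC q T) - q⁻¹ • (opC q T * opB q T) =
      (q - q⁻¹) • opα T - (q ^ 2 - q⁻¹ ^ 2) • opA T := by
  simp only [opA, opB, opC, opα, mul_add, add_mul, mul_sub, sub_mul, smul_mul_assoc, mul_smul_comm,
    hT, Prod.mk_add_mk, smul_add, smul_sub, smul_smul]
  norm_num
  match_scalars <;> field_simp <;> ring

end Realization

/-! ### Weights and leading terms of operators. -/

/-- The weight of an exponent. -/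
def weight : Expo →+ ℤ where
  toFun u := 2 * u.1 + 3 * u.2.2.1 + u.2.2.2.1 + 4 * u.2.2.2.2.1
  map_zero' := by simp
  map_add' u v := by simp only [Prod.fst_add, Prod.snd_add]; ring

theorem weight_mk (x k b g f m : ℤ) : weight (x, k, b, g, f, m) = 2 * x + 3 * b + g + 4 * f := rfl

section Leading

variable {F V : Type*} [Field F] [AddCommGroup V] [Module F V] {q : F} {b : Module.Basis Expo F V}

/-- The span of the basis vectors of weight less than `n`. -/
def lowWeight (b : Module.Basis Expo F V) (n : ℤ) : Submodule F V :=
  Submodule.span F (b '' {g | weight g < n})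

/-- The operators that raise weights by at most `n`. -/
def degLE (b : Module.Basis Expo F V) (n : ℤ) : Submodule F (Module.End F V) where
  carrier := {P | ∀ m, ∀ s ∈ lowWeight b m, P s ∈ lowWeight b (n + m)}
  zero_mem' _ _ _ := zero_mem _
  add_mem' hP hQ m s hs := add_mem (hP m s hs) (hQ m s hs)
  smul_mem' c _ hP m s hs := Submodule.smul_mem _ c (hP m s hs)

theorem lowWeight_mono {m n : ℤ} (h : m ≤ n) : lowWeight b m ≤ lowWeight b n :=
  Submodule.span_mono (Set.image_mono fun _ hg => lt_of_lt_of_le hg h)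

theorem apply_mem_lowWeight {n : ℤ} {g : Expo} (h : weight g < n) : b g ∈ lowWeight b n :=
  Submodule.subset_span ⟨g, h, rfl⟩

theorem repr_eq_zero_of_mem_lowWeight {n : ℤ} {s : V} (hs : s ∈ lowWeight b n) {g : Expo}
    (h : n ≤ weight g) : b.repr s g = 0 := by
  by_contra hne
  exact h.not_gt (b.mem_span_image.mp hs (Finsupp.mem_support_iff.mpr hne))

theorem degLE_mono {m n : ℤ} (h : m ≤ n) : degLE b m ≤ degLE b n :=
  fun _ hP k s hs => lowWeight_mono (by omega) (hP k s hs)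

theorem mul_mem_degLE {m n : ℤ} {P Q : Module.End F V} (hP : P ∈ degLE b m)
    (hQ : Q ∈ degLE b n) : P * Q ∈ degLE b (m + n) := by
  intro k s hs
  rw [add_assoc]
  exact hP _ _ (hQ _ _ hs)

theorem torus_mem_degLE {n : ℤ} (u : Expo) (h : weight u ≤ n) : torus b q u ∈ degLE b n := by
  intro m s hs
  induction hs using Submodule.span_induction with
  | mem x hx =>
    obtain ⟨g, hg, rfl⟩ := hx
    rw [torus_apply]
    refine Submodule.smul_mem _ _ (apply_mem_lowWeight ?_)
    rw [map_add]
    exact add_lt_add_of_le_of_lt h hg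
  | zero => rw [map_zero]; exact zero_mem _
  | add x y _ _ hx hy => rw [map_add]; exact add_mem hx hy
  | smul c x _ hx => rw [map_smul]; exact Submodule.smul_mem _ _ hx

/-- `P` is a nonzero multiple of `torus b q u` up to operators of smaller degree. -/
def HasLeading (b : Module.Basis Expo F V) (q : F) (P : Module.End F V) (u : Expo) : Prop :=
  ∃ c : F, c ≠ 0 ∧ P - c • torus b q u ∈ degLE b (weight u - 1)

namespace HasLeading

variable {P Q : Module.End F V} {u v : Expo}

theorem mem_degLE (h : HasLeading b q P u) : P ∈ degLE b (weight u) := by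
  obtain ⟨c, -, h⟩ := h
  rw [← sub_add_cancel P (c • torus b q u)]
  exact add_mem (degLE_mono (by omega) h) (Submodule.smul_mem _ _ (torus_mem_degLE u le_rfl))

theorem one : HasLeading b q (1 : Module.End F V) 0 :=
  ⟨1, one_ne_zero, by simp [torus_zero]⟩

/-- Leading coefficients multiply up to a power of `q`, hence stay nonzero. -/
theorem mul (hq : q ≠ 0) (hP : HasLeading b q P u) (hQ : HasLeading b q Q v) :
    HasLeading b q (P * Q) (u + v) := by
  have hQ' := hQ.mem_degLE
  obtain ⟨c, hc, hP⟩ := hP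
  obtain ⟨d, hd, hQ⟩ := hQ
  refine ⟨c * d * q ^ (2 * (u.2.1 * v.1)), mul_ne_zero (mul_ne_zero hc hd) (zpow_ne_zero _ hq), ?_⟩
  have key : P * Q - (c * d * q ^ (2 * (u.2.1 * v.1))) • torus b q (u + v) =
      (P - c • torus b q u) * Q + c • (torus b q u * (Q - d • torus b q v)) := by
    rw [← smul_smul, ← torus_mul hq, sub_mul, mul_sub, smul_sub, mul_smul_comm, smul_smul,
      smul_mul_assoc]
    abel
  rw [key, map_add]
  refine add_mem (degLE_mono (by omega) (mul_mem_degLE hP hQ')) (Submodule.smul_mem _ _ ?_)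
  exact degLE_mono (by omega) (mul_mem_degLE (torus_mem_degLE u le_rfl) hQ)

theorem pow (hq : q ≠ 0) (hP : HasLeading b q P u) (n : ℕ) : HasLeading b q (P ^ n) (n • u) := by
  induction n with
  | zero => simpa using one
  | succ n ih => rw [pow_succ, succ_nsmul]; exact ih.mul hq hP

theorem smul {a : F} (ha : a ≠ 0) (hP : HasLeading b q P u) : HasLeading b q (a • P) u := by
  obtain ⟨c, hc, hP⟩ := hP
  refine ⟨a * c, mul_ne_zero ha hc, ?_⟩
  rw [← smul_smul, ← smul_sub]
  exact Submodule.smul_mem _ _ hP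

theorem add (hP : HasLeading b q P u) (hQ : Q ∈ degLE b (weight u - 1)) :
    HasLeading b q (P + Q) u := by
  obtain ⟨c, hc, hP⟩ := hP
  refine ⟨c, hc, ?_⟩
  rw [add_sub_right_comm]
  exact add_mem hP hQ

theorem sub (hP : HasLeading b q P u) (hQ : Q ∈ degLE b (weight u - 1)) :
    HasLeading b q (P - Q) u := by
  rw [sub_eq_add_neg]
  exact hP.add (neg_mem hQ)

theorem torus (u : Expo) : HasLeading b q (torus b q u) u :=
  ⟨1, one_ne_zero, by simp⟩

/-- Evaluation at `b 0` turns the leading term into a coordinate. Several exponents may share a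
weight, so vanishing is also needed at the other exponents of weight equal to that of `u`. -/
theorem exists_repr (hP : HasLeading b q P u) :
    ∃ c : F, c ≠ 0 ∧ b.repr (P (b 0)) u = c ∧
      ∀ g, weight u ≤ weight g → g ≠ u → b.repr (P (b 0)) g = 0 := by
  obtain ⟨c, hc, h⟩ := hP
  have h1 := h 1 (b 0) (apply_mem_lowWeight (by simp))
  rw [sub_add_cancel] at h1
  have h2 (g : Expo) (hg : weight u ≤ weight g) :
      b.repr (P (b 0)) g = c * Finsupp.single u 1 g := by
    simpa [torus_apply, sub_eq_zero, -Finsupp.smul_single] using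
      repr_eq_zero_of_mem_lowWeight h1 hg
  refine ⟨c, hc, by simp [h2 u le_rfl], fun g hg hne => ?_⟩
  rw [h2 g hg, Finsupp.single_eq_of_ne hne, mul_zero]

end HasLeading

theorem linearIndependent_of_hasLeading {ι : Type*} {P : ι → Module.End F V}
    {u : ι → Expo} (hu : Function.Injective u) (h : ∀ i, HasLeading b q (P i) (u i)) :
    LinearIndependent F P := by
  classical
  rw [linearIndependent_iff']
  intro s g hg
  by_contra! hne
  obtain ⟨i, hi, hgi⟩ := hne
  -- Among the terms with nonzero coefficient, one of maximal leading weight is the only one to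
  -- contribute at its own leading exponent.
  obtain ⟨i₀, hi₀, hmax⟩ := Finset.exists_max_image (s.filter fun i => g i ≠ 0)
    (fun i => weight (u i)) ⟨i, by simp [hi, hgi]⟩
  rw [Finset.mem_filter] at hi₀
  obtain ⟨c, hc, hci, -⟩ := (h i₀).exists_repr
  have h0 : ∑ i ∈ s, g i * b.repr (P i (b 0)) (u i₀) = 0 := by
    have := congrArg (fun Q : Module.End F V => b.repr (Q (b 0)) (u i₀)) hg
    simpa [LinearMap.sum_apply, Finsupp.finsetSum_apply] using this
  rw [Finset.sum_eq_single_of_mem i₀ hi₀.1, hci] at h0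
  · exact mul_ne_zero hi₀.2 hc h0
  · intro j hj hji
    by_cases hgj : g j = 0
    · simp [hgj]
    · obtain ⟨-, -, -, h3⟩ := (h j).exists_repr
      rw [h3 _ (hmax j (by simp [hj, hgj])) fun e => hji (hu e).symm, mul_zero]

end Leading

/-! ### The homomorphism from `Δ` to the torus. -/

section Realization

variable {F R : Type*} [Field F] [Ring R] [Algebra F R] {q : F} {T : Expo → R}

theorem sq_sub_inv_sq_ne_zero (hq : q ≠ 0) (hq4 : q ^ 4 ≠ 1) : q ^ 2 - q⁻¹ ^ 2 ≠ 0 := by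
  intro h
  field_simp at h
  exact hq4 (by linear_combination h)

theorem add_inv_ne_zero (hq : q ≠ 0) (hq4 : q ^ 4 ≠ 1) : q + q⁻¹ ≠ 0 := fun h =>
  sq_sub_inv_sq_ne_zero hq hq4 (by linear_combination (q - q⁻¹) * h)

theorem smul_centralExpr (hq : q ≠ 0) (hq4 : q ^ 4 ≠ 1) {X Y Z W : R}
    (h : q • (Y * Z) - q⁻¹ • (Z * Y) = (q - q⁻¹) • W - (q ^ 2 - q⁻¹ ^ 2) • X) :
    (q + q⁻¹) • centralExpr q X Y Z = W := by
  have h2 : (q + q⁻¹) * ((q ^ 2 - q⁻¹ ^ 2)⁻¹ * (q - q⁻¹)) = 1 := by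
    have := sq_sub_inv_sq_ne_zero hq hq4
    rw [mul_left_comm, inv_mul_eq_one₀ this]
    ring
  rw [centralExpr, h, smul_sub, smul_smul, smul_smul,
    inv_mul_cancel₀ (sq_sub_inv_sq_ne_zero hq hq4), one_smul, add_sub_cancel, smul_smul, h2,
    one_smul]

/-- A monomial free of `X` and `K` picks up no power of `q`. -/
theorem commute_of_fst_eq_zero (hT : ∀ u v, T u * T v = q ^ (2 * (u.2.1 * v.1)) • T (u + v))
    {u : Expo} (h1 : u.1 = 0) (h2 : u.2.1 = 0) (v : Expo) : Commute (T u) (T v) := by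
  rw [commute_iff_eq, hT, hT, h1, h2, add_comm v u]
  simp

theorem commute_ops {x : R} (h : ∀ v, Commute x (T v)) :
    Commute x (opA T) ∧ Commute x (opB q T) ∧ Commute x (opC q T) := by
  have h' (v : Expo) : T v ∈ Subalgebra.centralizer F {x} := by
    rw [Subalgebra.mem_centralizer_iff]
    rintro _ rfl
    exact h v
  have key {y : R} (hy : y ∈ Subalgebra.centralizer F {x}) : Commute x y :=
    Subalgebra.mem_centralizer_iff F |>.mp hy x rfl
  refine ⟨key ?_, key ?_, key ?_⟩
  all_goals
    simp only [opA, opB, opC]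
    repeat first
      | apply add_mem
      | apply sub_mem
      | apply Subalgebra.smul_mem
      | apply h'

/-- The images of the generators. -/
def opGen (q : F) (T : Expo → R) : Gen → R
  | .A => opA T
  | .B => opB q T
  | .C => opC q T

theorem commute_lift_opGen {x : R} (h : ∀ v, Commute x (T v)) (y : FreeAlgebra F Gen) :
    Commute x (FreeAlgebra.lift F (opGen q T) y) := by
  induction y with
  | grade0 r => rw [AlgHom.commutes]; exact (Algebra.commute_algebraMap_right r x)
  | grade1 g =>
    rw [FreeAlgebra.lift_ι_apply]
    obtain ⟨hA, hB, hC⟩ := commute_ops (q := q) h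
    cases g <;> assumption
  | mul a b ha hb => rw [map_mul]; exact ha.mul_right hb
  | add a b ha hb => rw [map_add]; exact ha.add_right hb

theorem map_centralExpr {S : Type*} [Ring S] [Algebra F S] (f : R →ₐ[F] S) (X Y Z : R) :
    f (centralExpr q X Y Z) = centralExpr q (f X) (f Y) (f Z) := by
  simp [centralExpr]

theorem commute_opα (hT : ∀ u v, T u * T v = q ^ (2 * (u.2.1 * v.1)) • T (u + v)) (v : Expo) :
    Commute (opα T) (T v) :=
  (commute_of_fst_eq_zero hT rfl rfl v).add_left (commute_of_fst_eq_zero hT rfl rfl v)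

theorem commute_opβ (hT : ∀ u v, T u * T v = q ^ (2 * (u.2.1 * v.1)) • T (u + v)) (v : Expo) :
    Commute (opβ T) (T v) :=
  (commute_of_fst_eq_zero hT rfl rfl v).add_left (commute_of_fst_eq_zero hT rfl rfl v)

theorem commute_opγ (hT : ∀ u v, T u * T v = q ^ (2 * (u.2.1 * v.1)) • T (u + v)) (v : Expo) :
    Commute (opγ T) (T v) :=
  ((commute_of_fst_eq_zero hT rfl rfl v).add_left
    (commute_of_fst_eq_zero hT rfl rfl v)).add_left (commute_of_fst_eq_zero hT rfl rfl v)

theorem lift_opGen_rel (hq : q ≠ 0) (hq4 : q ^ 4 ≠ 1)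
    (hT : ∀ u v, T u * T v = q ^ (2 * (u.2.1 * v.1)) • T (u + v)) ⦃x y : FreeAlgebra F Gen⦄
    (h : Rel F q x y) :
    FreeAlgebra.lift F (opGen q T) x = FreeAlgebra.lift F (opGen q T) y := by
  have key {z w : R} (hz : (q + q⁻¹) • z = w) (hw : ∀ v, Commute w (T v))
      (y : FreeAlgebra F Gen) : z * FreeAlgebra.lift F (opGen q T) y =
        FreeAlgebra.lift F (opGen q T) y * z := by
    -- The relations concern the unscaled central expressions; since `q + q⁻¹ ≠ 0`, their centrality
    -- follows from that of the scaled ones.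
    obtain rfl : z = (q + q⁻¹)⁻¹ • w := by
      rw [← hz, smul_smul, inv_mul_cancel₀ (add_inv_ne_zero hq hq4), one_smul]
    exact (commute_lift_opGen hw y).smul_left _
  cases h with
  | alpha x =>
    simp only [map_mul, map_centralExpr, FreeAlgebra.lift_ι_apply]
    exact key (smul_centralExpr hq hq4 (q_mul_opB_opC hq hT)) (commute_opα hT) x
  | beta x =>
    simp only [map_mul, map_centralExpr, FreeAlgebra.lift_ι_apply]
    exact key (smul_centralExpr hq hq4 (q_mul_opC_opA hq hT)) (commute_opβ hT) x
  | gamma x =>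
    simp only [map_mul, map_centralExpr, FreeAlgebra.lift_ι_apply]
    exact key (smul_centralExpr hq hq4 (q_mul_opA_opB hq hT)) (commute_opγ hT) x

/-- The homomorphism from `Δ` to an algebra that contains a quantum torus. -/
noncomputable def realization (hq : q ≠ 0) (hq4 : q ^ 4 ≠ 1)
    (hT : ∀ u v, T u * T v = q ^ (2 * (u.2.1 * v.1)) • T (u + v)) : Delta F q →ₐ[F] R :=
  RingQuot.liftAlgHom F ⟨FreeAlgebra.lift F (opGen q T), lift_opGen_rel hq hq4 hT⟩

variable (hq : q ≠ 0) (hq4 : q ^ 4 ≠ 1)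
    (hT : ∀ u v, T u * T v = q ^ (2 * (u.2.1 * v.1)) • T (u + v))

theorem realization_gen (g : Gen) : realization hq hq4 hT (gen q g) = opGen q T g := by
  rw [realization, gen, RingQuot.liftAlgHom_mkAlgHom_apply, FreeAlgebra.lift_ι_apply]

theorem realization_A : realization hq hq4 hT (A q) = opA T := realization_gen hq hq4 hT .A

theorem realization_B : realization hq hq4 hT (B q) = opB q T := realization_gen hq hq4 hT .B

theorem realization_C : realization hq hq4 hT (C q) = opC q T := realization_gen hq hq4 hT .C

theorem realization_α : realization hq hq4 hT (α q) = opα T := by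
  rw [α, map_smul, map_centralExpr, realization_A, realization_B, realization_C]
  exact smul_centralExpr hq hq4 (q_mul_opB_opC hq hT)

theorem realization_β : realization hq hq4 hT (β q) = opβ T := by
  rw [β, map_smul, map_centralExpr, realization_A, realization_B, realization_C]
  exact smul_centralExpr hq hq4 (q_mul_opC_opA hq hT)

theorem realization_γ : realization hq hq4 hT (γ q) = opγ T := by
  rw [γ, map_smul, map_centralExpr, realization_A, realization_B, realization_C]
  exact smul_centralExpr hq hq4 (q_mul_opA_opB hq hT)

end Realization

/-! ### Leading terms of the family and linear independence. -/

section Leading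

variable {F V : Type*} [Field F] [AddCommGroup V] [Module F V] {q : F} {b : Module.Basis Expo F V}

theorem hasLeading_opA : HasLeading b q (opA (torus b q)) (1, 0, 0, 0, 0, 0) := by
  rw [opA]
  refine ((HasLeading.torus _).add ?_).add ?_ <;>
    exact torus_mem_degLE _ (by simp [weight_mk])

theorem hasLeading_opB : HasLeading b q (opB q (torus b q)) (0, 1, 1, 0, 0, 0) := by
  rw [opB]
  refine ((((((HasLeading.torus _).add ?_).add ?_).sub ?_).add ?_).sub ?_).add ?_ <;>
    first
    | exact torus_mem_degLE _ (by simp [weight_mk])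
    | exact Submodule.smul_mem _ _ (torus_mem_degLE _ (by simp [weight_mk]))

theorem hasLeading_opC (hq : q ≠ 0) :
    HasLeading b q (opC q (torus b q)) (-1, -1, 0, 0, 1, 0) := by
  rw [opC]
  refine ((((((((HasLeading.torus _).smul (neg_ne_zero.mpr hq)).sub ?_).sub ?_).add ?_).add
    ?_).sub ?_).add ?_).sub ?_ <;>
    first
    | exact torus_mem_degLE _ (by simp [weight_mk])
    | exact Submodule.smul_mem _ _ (torus_mem_degLE _ (by simp [weight_mk]))

theorem hasLeading_opα : HasLeading b q (opα (torus b q)) (0, 0, 1, 0, 0, 1) :=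
  (HasLeading.torus _).add (torus_mem_degLE _ (by simp [weight_mk]))

theorem hasLeading_opβ : HasLeading b q (opβ (torus b q)) (0, 0, 0, 1, 0, 0) :=
  (HasLeading.torus _).add (torus_mem_degLE _ (by simp [weight_mk]))

theorem hasLeading_opγ : HasLeading b q (opγ (torus b q)) (0, 0, 0, 0, 1, 0) :=
  ((HasLeading.torus _).add (torus_mem_degLE _ (by simp [weight_mk]))).add
    (torus_mem_degLE _ (by simp [weight_mk]))

theorem hasLeading_realization_Ω (hq : q ≠ 0) (hq4 : q ^ 4 ≠ 1) :
    HasLeading b q (realization hq hq4 (torus_mul (b := b) hq) (Ω q)) (0, 0, 1, 0, 1, 0) := by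
  have hA := hasLeading_opA (q := q) (b := b)
  have hB := hasLeading_opB (q := q) (b := b)
  have hC := hasLeading_opC (b := b) hq
  have hα := hasLeading_opα (q := q) (b := b)
  have hβ := hasLeading_opβ (q := q) (b := b)
  have hγ := hasLeading_opγ (q := q) (b := b)
  simp only [Ω, map_sub, map_add, map_smul, map_mul, map_pow, realization_A, realization_B,
    realization_C, realization_α, realization_β, realization_γ]
  have hABC := (((hA.mul hq hB).mul hq hC).smul hq)
  -- The powers of `X` and `K` cancel in the leading term of `A B C`, leaving `b f` of weight 7;
  -- every other term of `Ω` has weight at most 6.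
  rw [show ((1, 0, 0, 0, 0, 0) + (0, 1, 1, 0, 0, 0) + (-1, -1, 0, 0, 1, 0) : Expo) =
    (0, 0, 1, 0, 1, 0) by simp] at hABC
  have low {Q : Module.End F V} {u : Expo} (c : F) (hQ : HasLeading b q Q u)
      (hu : weight u ≤ weight (0, 0, 1, 0, 1, 0) - 1) :
      c • Q ∈ degLE b (weight (0, 0, 1, 0, 1, 0) - 1) :=
    Submodule.smul_mem _ _ (degLE_mono hu hQ.mem_degLE)
  refine (((((hABC.add (low _ (hA.pow hq 2) ?_)).add (low _ (hB.pow hq 2) ?_)).add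
    (low _ (hC.pow hq 2) ?_)).sub (low _ (hA.mul hq hα) ?_)).sub (low _ (hB.mul hq hβ) ?_)).sub
    (low _ (hC.mul hq hγ) ?_) <;> simp [weight_mk]

/-- The leading exponent of the image of `A^i B^j C^k Ω^ℓ α^r β^s γ^t`. -/
def leadingExpo (m : Index) : Expo :=
  (m.i - m.k, m.j - m.k, m.j + m.l + m.r, m.s, m.k + m.l + m.t, m.r)

/-- The first two entries fix `(i, j, k)` up to a common shift, and `ijk = 0` fixes the shift. The
other entries then give `s`, `r`, `l`, `t`. -/
theorem leadingExpo_injective : Function.Injective leadingExpo := by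
  rintro ⟨i, j, k, l, r, s, t, h⟩ ⟨i', j', k', l', r', s', t', h'⟩ he
  simp only [leadingExpo, Prod.mk.injEq] at he
  simp only [mul_eq_zero] at h h'
  simp only [Index.mk.injEq]
  omega

theorem hasLeading_realization_monomial (hq : q ≠ 0) (hq4 : q ^ 4 ≠ 1) (m : Index) :
    HasLeading b q (realization hq hq4 (torus_mul (b := b) hq)
      (monomial q m.i m.j m.k m.l m.r m.s m.t)) (leadingExpo m) := by
  have h := ((((((hasLeading_opA.pow hq m.i).mul hq (hasLeading_opB.pow hq m.j)).mul hq
    ((hasLeading_opC hq).pow hq m.k)).mul hq ((hasLeading_realization_Ω hq hq4).pow hq m.l)).mul hq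
    (hasLeading_opα.pow hq m.r)).mul hq (hasLeading_opβ.pow hq m.s)).mul hq
    (hasLeading_opγ (b := b).pow hq m.t)
  simp only [monomial, map_mul, map_pow, realization_A, realization_B, realization_C,
    realization_α, realization_β, realization_γ]
  convert h using 1
  simp [leadingExpo, sub_eq_add_neg]

theorem linearIndependent_monomial_of_basis (b : Module.Basis Expo F V) (hq : q ≠ 0)
    (hq4 : q ^ 4 ≠ 1) :
    LinearIndependent F fun m : Index => monomial q m.i m.j m.k m.l m.r m.s m.t :=
  LinearIndependent.of_comp (realization hq hq4 (torus_mul (b := b) hq)).toLinearMap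
    (linearIndependent_of_hasLeading leadingExpo_injective
      (hasLeading_realization_monomial hq hq4))

end Leading

theorem linearIndependent_monomial {F : Type*} [Field F] {q : F} (hq : q ≠ 0) (hq4 : q ^ 4 ≠ 1) :
    LinearIndependent F fun m : Index => monomial q m.i m.j m.k m.l m.r m.s m.t :=
  linearIndependent_monomial_of_basis (Finsupp.basisSingleOne (R := F)) hq hq4

/-! ### Central elements and the degree filtration. -/

section Spanning

variable {F : Type*} [Field F] {q : F}

theorem mkAlgHom_centralExpr (X Y Z : Gen) :
    RingQuot.mkAlgHom F (Rel F q)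
      (centralExpr q (FreeAlgebra.ι F X) (FreeAlgebra.ι F Y) (FreeAlgebra.ι F Z)) =
    centralExpr q (gen q X) (gen q Y) (gen q Z) :=
  map_centralExpr _ _ _ _

theorem commute_α (x : Delta F q) : Commute (α q) x := by
  obtain ⟨y, rfl⟩ := RingQuot.mkAlgHom_surjective F (Rel F q) x
  have h := RingQuot.mkAlgHom_rel F (Rel.alpha (q := q) y)
  rw [map_mul, map_mul, mkAlgHom_centralExpr] at h
  exact Commute.smul_left h _

theorem commute_β (x : Delta F q) : Commute (β q) x := by
  obtain ⟨y, rfl⟩ := RingQuot.mkAlgHom_surjective F (Rel F q) x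
  have h := RingQuot.mkAlgHom_rel F (Rel.beta (q := q) y)
  rw [map_mul, map_mul, mkAlgHom_centralExpr] at h
  exact Commute.smul_left h _

theorem commute_γ (x : Delta F q) : Commute (γ q) x := by
  obtain ⟨y, rfl⟩ := RingQuot.mkAlgHom_surjective F (Rel F q) x
  have h := RingQuot.mkAlgHom_rel F (Rel.gamma (q := q) y)
  rw [map_mul, map_mul, mkAlgHom_centralExpr] at h
  exact Commute.smul_left h _

variable (F q) in
/-- The span of the monomials in `α`, `β`, `γ`. -/
def centralSpan : Submodule F (Delta F q) :=
  Submodule.span F (Set.range fun p : ℕ × ℕ × ℕ => α q ^ p.1 * β q ^ p.2.1 * γ q ^ p.2.2)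

variable (F q) in
/-- The span of the unit and the generators. -/
def letterSpan : Submodule F (Delta F q) :=
  Submodule.span F {1, A q, B q, C q}

variable (F q) in
/-- The filtration of `Δ` by the degree in `A`, `B`, `C`, with `α`, `β`, `γ` in degree `0`. -/
def filt (n : ℕ) : Submodule F (Delta F q) := centralSpan F q * letterSpan F q ^ n

theorem pow_mul_pow_mem_centralSpan (r s t : ℕ) :
    α q ^ r * β q ^ s * γ q ^ t ∈ centralSpan F q :=
  Submodule.subset_span ⟨(r, s, t), rfl⟩

theorem one_mem_centralSpan : (1 : Delta F q) ∈ centralSpan F q := by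
  simpa using pow_mul_pow_mem_centralSpan (q := q) 0 0 0

theorem one_mem_letterSpan : (1 : Delta F q) ∈ letterSpan F q :=
  Submodule.subset_span (by simp)

theorem commute_of_mem_centralSpan {z : Delta F q} (hz : z ∈ centralSpan F q) (x : Delta F q) :
    Commute z x := by
  induction hz using Submodule.span_induction with
  | mem z hz =>
    obtain ⟨p, rfl⟩ := hz
    exact (((commute_α x).pow_left _).mul_left ((commute_β x).pow_left _)).mul_left
      ((commute_γ x).pow_left _)
  | zero => exact Commute.zero_left x
  | add _ _ _ _ h₁ h₂ => exact h₁.add_left h₂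
  | smul c _ _ h => exact h.smul_left c

theorem central_mul_central (r s t r' s' t' : ℕ) :
    α q ^ r * β q ^ s * γ q ^ t * (α q ^ r' * β q ^ s' * γ q ^ t') =
      α q ^ (r + r') * β q ^ (s + s') * γ q ^ (t + t') := by
  rw [((commute_γ _).pow_left t).mul_mul_mul_comm, ((commute_β _).pow_left s).mul_mul_mul_comm,
    pow_add, pow_add, pow_add]

theorem centralSpan_mul_self : centralSpan F q * centralSpan F q = centralSpan F q := by
  refine le_antisymm ?_ fun x hx => ?_
  · rw [centralSpan, Submodule.span_mul_span, Submodule.span_le]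
    rintro _ ⟨_, ⟨p, rfl⟩, _, ⟨p', rfl⟩, rfl⟩
    exact Submodule.subset_span ⟨p + p', (central_mul_central _ _ _ _ _ _).symm⟩
  · simpa using Submodule.mul_mem_mul hx one_mem_centralSpan

theorem commute_centralSpan (M : Submodule F (Delta F q)) : Commute (centralSpan F q) M :=
  Submodule.mul_comm_of_commute fun _ hz x _ => commute_of_mem_centralSpan hz x

theorem filt_zero : filt F q 0 = centralSpan F q := by
  rw [filt, pow_zero, mul_one]

theorem filt_succ (n : ℕ) : filt F q (n + 1) = letterSpan F q * filt F q n := by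
  rw [filt, filt, pow_succ', ← mul_assoc, (commute_centralSpan _).eq, mul_assoc]

theorem mul_mem_filt {m n : ℕ} {x y : Delta F q} (hx : x ∈ filt F q m) (hy : y ∈ filt F q n) :
    x * y ∈ filt F q (m + n) := by
  have : filt F q m * filt F q n = filt F q (m + n) := by
    rw [filt, filt, ((commute_centralSpan _).symm).mul_mul_mul_comm, centralSpan_mul_self,
      ← pow_add, filt]
  rw [← this]
  exact Submodule.mul_mem_mul hx hy

theorem filt_mono : Monotone (filt F q) := by
  refine monotone_nat_of_le_succ fun n x hx => ?_
  rw [filt_succ]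
  simpa using Submodule.mul_mem_mul one_mem_letterSpan hx

theorem mem_filt_of_le {m n : ℕ} {x : Delta F q} (hx : x ∈ filt F q m) (h : m ≤ n) :
    x ∈ filt F q n :=
  filt_mono h hx

theorem pow_mem_filt {m : ℕ} {x : Delta F q} (hx : x ∈ filt F q m) (n : ℕ) :
    x ^ n ∈ filt F q (n * m) := by
  induction n with
  | zero => simpa [filt_zero] using one_mem_centralSpan
  | succ n ih => rw [pow_succ, add_mul, one_mul]; exact mul_mem_filt ih hx

theorem mem_filt_one {x : Delta F q} (hx : x ∈ letterSpan F q) : x ∈ filt F q 1 := by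
  simpa [filt] using Submodule.mul_mem_mul one_mem_centralSpan hx

theorem A_mem_filt : A q ∈ filt F q 1 := mem_filt_one (Submodule.subset_span (by simp))

theorem B_mem_filt : B q ∈ filt F q 1 := mem_filt_one (Submodule.subset_span (by simp))

theorem C_mem_filt : C q ∈ filt F q 1 := mem_filt_one (Submodule.subset_span (by simp))

theorem α_mem_filt : α q ∈ filt F q 0 := by
  simpa [filt_zero] using pow_mul_pow_mem_centralSpan (q := q) 1 0 0

theorem β_mem_filt : β q ∈ filt F q 0 := by
  simpa [filt_zero] using pow_mul_pow_mem_centralSpan (q := q) 0 1 0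

theorem γ_mem_filt : γ q ∈ filt F q 0 := by
  simpa [filt_zero] using pow_mul_pow_mem_centralSpan (q := q) 0 0 1

theorem exists_mem_filt (x : Delta F q) : ∃ n, x ∈ filt F q n := by
  obtain ⟨y, rfl⟩ := RingQuot.mkAlgHom_surjective F (Rel F q) x
  induction y with
  | grade0 r =>
    refine ⟨0, ?_⟩
    rw [AlgHom.commutes, Algebra.algebraMap_eq_smul_one, filt_zero]
    exact Submodule.smul_mem _ _ one_mem_centralSpan
  | grade1 g =>
    refine ⟨1, ?_⟩
    cases g
    exacts [A_mem_filt, B_mem_filt, C_mem_filt]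
  | mul a b ha hb =>
    obtain ⟨m, hm⟩ := ha
    obtain ⟨n, hn⟩ := hb
    exact ⟨m + n, by rw [map_mul]; exact mul_mem_filt hm hn⟩
  | add a b ha hb =>
    obtain ⟨m, hm⟩ := ha
    obtain ⟨n, hn⟩ := hb
    exact ⟨max m n, by
      rw [map_add]; exact add_mem (filt_mono (le_max_left _ _) hm) (filt_mono (le_max_right _ _) hn)⟩

/-! ### Reordering modulo lower degree. -/

/-- `x` is a scalar multiple of `y` modulo `filt F q n`. -/
def MultipleMod (n : ℕ) (x y : Delta F q) : Prop := ∃ c : F, x - c • y ∈ filt F q n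

namespace MultipleMod

variable {m n : ℕ} {x y z : Delta F q}

theorem refl (n : ℕ) (x : Delta F q) : MultipleMod n x x := ⟨1, by simp⟩

theorem trans (hxy : MultipleMod n x y) (hyz : MultipleMod n y z) : MultipleMod n x z := by
  obtain ⟨c, hc⟩ := hxy
  obtain ⟨d, hd⟩ := hyz
  refine ⟨c * d, ?_⟩
  have : x - (c * d) • z = (x - c • y) + c • (y - d • z) := by
    rw [smul_sub, smul_smul]; abel
  rw [this]
  exact add_mem hc (Submodule.smul_mem _ _ hd)

theorem mono (h : MultipleMod m x y) (hmn : m ≤ n) : MultipleMod n x y :=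
  h.imp fun _ hc => filt_mono hmn hc

theorem mul_left (hz : z ∈ filt F q m) (h : MultipleMod n x y) :
    MultipleMod (m + n) (z * x) (z * y) := by
  obtain ⟨c, hc⟩ := h
  refine ⟨c, ?_⟩
  rw [← mul_smul_comm, ← mul_sub]
  exact mul_mem_filt hz hc

theorem mul_right (h : MultipleMod n x y) (hz : z ∈ filt F q m) :
    MultipleMod (n + m) (x * z) (y * z) := by
  obtain ⟨c, hc⟩ := h
  refine ⟨c, ?_⟩
  rw [← smul_mul_assoc, ← sub_mul]
  exact mul_mem_filt hc hz

theorem mul_pow (hx : x ∈ filt F q 1) (h : MultipleMod 1 (y * x) (x * y)) (i : ℕ) :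
    MultipleMod i (y * x ^ i) (x ^ i * y) := by
  induction i with
  | zero => simpa using refl 0 y
  | succ i ih =>
    have h1 := ih.mul_right hx
    have h2 := h.mul_left (pow_mem_filt hx i)
    rw [mul_one] at h2
    simpa only [pow_succ, mul_assoc] using h1.trans (by simpa only [mul_assoc] using h2)

end MultipleMod

theorem sub_smul_mem_filt (hq : q ≠ 0) (hq4 : q ^ 4 ≠ 1) {X Y Z W : Delta F q}
    (hX : X ∈ filt F q 1) (hW : W ∈ filt F q 0) (h : (q + q⁻¹) • centralExpr q X Y Z = W) :
    MultipleMod 1 (Z * Y) (Y * Z) ∧ MultipleMod 1 (Y * Z) (Z * Y) := by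
  have hd := sq_sub_inv_sq_ne_zero hq hq4
  have hs := add_inv_ne_zero hq hq4
  have key : q • (Y * Z) - q⁻¹ • (Z * Y) ∈ filt F q 1 := by
    have : q • (Y * Z) - q⁻¹ • (Z * Y) =
        (q ^ 2 - q⁻¹ ^ 2) • ((q + q⁻¹)⁻¹ • W - X) := by
      rw [← h, smul_smul, inv_mul_cancel₀ hs, one_smul, centralExpr, add_sub_cancel_left,
        smul_smul, mul_inv_cancel₀ hd, one_smul]
    rw [this]
    exact Submodule.smul_mem _ _
      (sub_mem (Submodule.smul_mem _ _ (filt_mono zero_le_one hW)) hX)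
  refine ⟨⟨q ^ 2, ?_⟩, ⟨q⁻¹ ^ 2, ?_⟩⟩
  -- The factors `-q` here and `q⁻¹` below normalise the coefficient of `Z Y`, respectively `Y Z`,
  -- to 1.
  · convert Submodule.smul_mem _ (-q) key using 1
    match_scalars <;> field_simp
  · convert Submodule.smul_mem _ q⁻¹ key using 1
    match_scalars <;> field_simp

theorem mul_mul_multipleMod_Ω (hq : q ≠ 0) : MultipleMod 2 (A q * B q * C q) (Ω q) := by
  refine ⟨q⁻¹, ?_⟩
  have hA := A_mem_filt (q := q)
  have hB := B_mem_filt (q := q)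
  have hC := C_mem_filt (q := q)
  have key : q ^ 2 • A q ^ 2 + q⁻¹ ^ 2 • B q ^ 2 + q ^ 2 • C q ^ 2
    - q • (A q * α q) - q⁻¹ • (B q * β q) - q • (C q * γ q) ∈ filt F q 2 := by
    refine sub_mem (sub_mem (sub_mem (add_mem (add_mem ?_ ?_) ?_) ?_) ?_) ?_ <;>
      apply Submodule.smul_mem
    exacts [mem_filt_of_le (pow_mem_filt hA 2) (by norm_num),
      mem_filt_of_le (pow_mem_filt hB 2) (by norm_num),
      mem_filt_of_le (pow_mem_filt hC 2) (by norm_num),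
      mem_filt_of_le (mul_mem_filt hA α_mem_filt) (by norm_num),
      mem_filt_of_le (mul_mem_filt hB β_mem_filt) (by norm_num),
      mem_filt_of_le (mul_mem_filt hC γ_mem_filt) (by norm_num)]
  convert Submodule.smul_mem _ (-q⁻¹) key using 1
  rw [Ω]
  match_scalars <;> field_simp <;> ring

theorem Ω_mem_filt : Ω q ∈ filt F q 3 := by
  have hA := A_mem_filt (q := q)
  have hB := B_mem_filt (q := q)
  have hC := C_mem_filt (q := q)
  rw [Ω]
  refine sub_mem (sub_mem (sub_mem (add_mem (add_mem (add_mem ?_ ?_) ?_) ?_) ?_) ?_) ?_ <;>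
    apply Submodule.smul_mem
  exacts [mem_filt_of_le (mul_mem_filt (mul_mem_filt hA hB) hC) (by norm_num),
    mem_filt_of_le (pow_mem_filt hA 2) (by norm_num),
    mem_filt_of_le (pow_mem_filt hB 2) (by norm_num),
    mem_filt_of_le (pow_mem_filt hC 2) (by norm_num),
    mem_filt_of_le (mul_mem_filt hA α_mem_filt) (by norm_num),
    mem_filt_of_le (mul_mem_filt hB β_mem_filt) (by norm_num),
    mem_filt_of_le (mul_mem_filt hC γ_mem_filt) (by norm_num)]

theorem B_mul_multipleMod (hq : q ≠ 0) (hq4 : q ^ 4 ≠ 1) (i j k : ℕ) :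
    MultipleMod (i + j + k) (B q * (A q ^ i * B q ^ j * C q ^ k))
      (A q ^ i * B q ^ (j + 1) * C q ^ k) := by
  have hBA := (sub_smul_mem_filt hq hq4 C_mem_filt γ_mem_filt rfl).1.mul_pow A_mem_filt i
  have h := (hBA.mul_right (pow_mem_filt B_mem_filt j)).mul_right (pow_mem_filt C_mem_filt k)
  simpa only [mul_one, pow_succ', mul_assoc] using h

theorem C_mul_multipleMod (hq : q ≠ 0) (hq4 : q ^ 4 ≠ 1) (i j k : ℕ) :
    MultipleMod (i + j + k) (C q * (A q ^ i * B q ^ j * C q ^ k))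
      (A q ^ i * B q ^ j * C q ^ (k + 1)) := by
  have hCA := (sub_smul_mem_filt hq hq4 B_mem_filt β_mem_filt rfl).2.mul_pow A_mem_filt i
  have hCB := (sub_smul_mem_filt hq hq4 A_mem_filt α_mem_filt rfl).1.mul_pow B_mem_filt j
  have h1 := (hCA.mul_right (pow_mem_filt B_mem_filt j)).mul_right (pow_mem_filt C_mem_filt k)
  have h2 := (hCB.mul_left (pow_mem_filt A_mem_filt i)).mul_right (pow_mem_filt C_mem_filt k)
  simp only [mul_one, pow_succ', mul_assoc] at h1 h2 ⊢
  exact h1.trans h2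

/-- One `A`, one `B` and one `C` are gathered to the right of `A^i B^j C^k`, so the resulting `Ω`
already stands in its place. -/
theorem monomial_succ_multipleMod (hq : q ≠ 0) (hq4 : q ^ 4 ≠ 1) (i j k : ℕ) :
    MultipleMod (i + j + k + 2) (A q ^ (i + 1) * B q ^ (j + 1) * C q ^ (k + 1))
      (A q ^ i * B q ^ j * C q ^ k * Ω q) := by
  have hA := pow_mem_filt (A_mem_filt (q := q)) i
  have hB := pow_mem_filt (B_mem_filt (q := q)) j
  have hC := pow_mem_filt (C_mem_filt (q := q)) k
  have hAB := (sub_smul_mem_filt hq hq4 C_mem_filt γ_mem_filt rfl).2.mul_pow B_mem_filt j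
  have hAC := (sub_smul_mem_filt hq hq4 B_mem_filt β_mem_filt rfl).1.mul_pow C_mem_filt k
  have hBC := (sub_smul_mem_filt hq hq4 A_mem_filt α_mem_filt rfl).2.mul_pow C_mem_filt k
  -- In turn, `A` passes `B^j`, `B` passes `C^k`, `A` passes `C^k`, and `A B C` becomes `Ω`.
  have h1 := (hAB.mul_left hA).mul_right
    (mul_mem_filt B_mem_filt (mul_mem_filt hC C_mem_filt))
  have h2 := (hBC.mul_left (mul_mem_filt (mul_mem_filt hA hB) A_mem_filt)).mul_right C_mem_filt
  have h3 := (hAC.mul_left (mul_mem_filt hA hB)).mul_right (mul_mem_filt B_mem_filt C_mem_filt)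
  have h4 := (mul_mul_multipleMod_Ω hq).mul_left (mul_mem_filt (mul_mem_filt hA hB) hC)
  simp only [mul_one, pow_succ, mul_assoc] at h1 h2 h3 h4 ⊢
  exact (((h1.mono (by omega)).trans (h2.mono (by omega))).trans (h3.mono (by omega))).trans
    (h4.mono (by omega))

/-! ### Spanning by induction on the degree. -/

variable (F q) in
/-- The span of the index monomials of degree at most `n`. -/
def monomialSpan (n : ℕ) : Submodule F (Delta F q) :=
  Submodule.span F ((fun m : Index => monomial q m.i m.j m.k m.l m.r m.s m.t) ''
    {m | m.i + m.j + m.k + 3 * m.l ≤ n})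

theorem monomial_mem_monomialSpan {n i j k l r s t : ℕ} (h : i * j * k = 0)
    (hn : i + j + k + 3 * l ≤ n) : monomial q i j k l r s t ∈ monomialSpan F q n :=
  Submodule.subset_span ⟨⟨i, j, k, l, r, s, t, h⟩, hn, rfl⟩

theorem monomialSpan_mono : Monotone (monomialSpan F q) := fun _ _ h =>
  Submodule.span_mono (Set.image_mono fun _ hm => le_trans hm h)

theorem MultipleMod.mul_mem_monomialSpan {n e l : ℕ} {x y z : Delta F q}
    (h : MultipleMod e x y) (ih : filt F q n ≤ monomialSpan F q n) (hn : e + 3 * l ≤ n)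
    (hz : z ∈ centralSpan F q) (hy : y * Ω q ^ l * z ∈ monomialSpan F q (n + 1)) :
    x * Ω q ^ l * z ∈ monomialSpan F q (n + 1) := by
  obtain ⟨c, hc⟩ := h
  have : x * Ω q ^ l * z = (x - c • y) * Ω q ^ l * z + c • (y * Ω q ^ l * z) := by
    rw [sub_mul, sub_mul, smul_mul_assoc, smul_mul_assoc, sub_add_cancel]
  rw [this]
  -- The error term has degree at most `e + 3 * l ≤ n`, where the induction hypothesis applies.
  refine add_mem (monomialSpan_mono n.le_succ (ih ?_)) (Submodule.smul_mem _ _ hy)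
  rw [← filt_zero] at hz
  exact filt_mono (by omega) (mul_mem_filt (mul_mem_filt hc (pow_mem_filt Ω_mem_filt l)) hz)

theorem monomial_eq (i j k l r s t : ℕ) : monomial q i j k l r s t =
    A q ^ i * B q ^ j * C q ^ k * Ω q ^ l * (α q ^ r * β q ^ s * γ q ^ t) := by
  simp only [monomial, mul_assoc]

/-- Trading `A B C` for `Ω` preserves `i + j + k + 3l`. The disjunction says that at most one trade
is needed, which is the case after one letter is added to an admissible monomial. -/
theorem mul_mem_monomialSpan_of_filt_le (hq : q ≠ 0) (hq4 : q ^ 4 ≠ 1) {n : ℕ}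
    (ih : filt F q n ≤ monomialSpan F q n) {i j k l : ℕ} (r s t : ℕ)
    (h : i * j * k = 0 ∨ (i - 1) * (j - 1) * (k - 1) = 0) (hn : i + j + k + 3 * l ≤ n + 1) :
    A q ^ i * B q ^ j * C q ^ k * Ω q ^ l * (α q ^ r * β q ^ s * γ q ^ t) ∈
      monomialSpan F q (n + 1) := by
  by_cases h0 : i * j * k = 0
  · rw [← monomial_eq]
    exact monomial_mem_monomialSpan h0 hn
  · obtain ⟨⟨hi, hj⟩, hk⟩ : (i ≠ 0 ∧ j ≠ 0) ∧ k ≠ 0 := by simpa [not_or] using h0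
    obtain ⟨i, rfl⟩ := Nat.exists_eq_succ_of_ne_zero hi
    obtain ⟨j, rfl⟩ := Nat.exists_eq_succ_of_ne_zero hj
    obtain ⟨k, rfl⟩ := Nat.exists_eq_succ_of_ne_zero hk
    refine (monomial_succ_multipleMod hq hq4 i j k).mul_mem_monomialSpan ih (by omega)
      (pow_mul_pow_mem_centralSpan r s t) ?_
    rw [mul_assoc _ (Ω q), ← pow_succ', ← monomial_eq]
    exact monomial_mem_monomialSpan (by simpa using h.resolve_left h0) (by omega)

theorem filt_le_monomialSpan (hq : q ≠ 0) (hq4 : q ^ 4 ≠ 1) (n : ℕ) :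
    filt F q n ≤ monomialSpan F q n := by
  induction n with
  | zero =>
    rw [filt_zero, centralSpan, Submodule.span_le]
    rintro _ ⟨⟨r, s, t⟩, rfl⟩
    simpa [monomial_eq] using
      monomial_mem_monomialSpan (q := q) (i := 0) (j := 0) (k := 0) (l := 0) (r := r) (s := s)
        (t := t) rfl le_rfl
  | succ n ih =>
    rw [filt_succ]
    refine (mul_le_mul' le_rfl ih).trans ?_
    rw [letterSpan, monomialSpan, Submodule.span_mul_span, Submodule.span_le]
    rintro _ ⟨p, hp, _, ⟨⟨i, j, k, l, r, s, t, h⟩, hm, rfl⟩, rfl⟩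
    replace hm : i + j + k + 3 * l ≤ n := hm
    have hz := pow_mul_pow_mem_centralSpan (q := q) r s t
    have h' : (i = 0 ∨ j = 0) ∨ k = 0 := by simpa using h
    simp only [monomial_eq, SetLike.mem_coe]
    rw [← mul_assoc p, ← mul_assoc p]
    rcases hp with rfl | rfl | rfl | rfl
    · rw [one_mul, ← monomial_eq]
      exact monomial_mem_monomialSpan h (by omega)
    -- A factor `A` is already in position; `B` and `C` must first move past the powers before their
    -- own.
    · rw [← mul_assoc (A q), ← mul_assoc (A q), ← pow_succ']
      refine mul_mem_monomialSpan_of_filt_le hq hq4 ih r s t ?_ (by omega)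
      rcases h' with (rfl | rfl) | rfl <;> simp
    · refine (B_mul_multipleMod hq hq4 i j k).mul_mem_monomialSpan ih (by omega) hz ?_
      refine mul_mem_monomialSpan_of_filt_le hq hq4 ih r s t ?_ (by omega)
      rcases h' with (rfl | rfl) | rfl <;> simp
    · refine (C_mul_multipleMod hq hq4 i j k).mul_mem_monomialSpan ih (by omega) hz ?_
      refine mul_mem_monomialSpan_of_filt_le hq hq4 ih r s t ?_ (by omega)
      rcases h' with (rfl | rfl) | rfl <;> simp

theorem span_monomial (hq : q ≠ 0) (hq4 : q ^ 4 ≠ 1) :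
    Submodule.span F (Set.range fun m : Index => monomial q m.i m.j m.k m.l m.r m.s m.t) = ⊤ := by
  refine eq_top_iff.mpr fun x _ => ?_
  obtain ⟨n, hn⟩ := exists_mem_filt x
  exact Submodule.span_mono (Set.image_subset_range _ _) (filt_le_monomialSpan hq hq4 n hn)

end Spanning

end UniversalAskeyWilson

open UniversalAskeyWilson in
/-- The elements `A^i B^j C^k Ω^ℓ α^r β^s γ^t` with `i, j, k, ℓ, r, s, t ≥ 0` and `i j k = 0`
form a basis of the `F`-vector space `Δ`: the family they form is linearly independent, and
it spans `Δ`. -/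
theorem theorem6p6 {F : Type*} [Field F] (q : F) (hq : q ≠ 0) (hq4 : q ^ 4 ≠ 1) :
    LinearIndependent F
      (fun m : Index => monomial q m.i m.j m.k m.l m.r m.s m.t) ∧
    Submodule.span F (Set.range
      (fun m : Index => monomial q m.i m.j m.k m.l m.r m.s m.t)) = ⊤ := by
  exact ⟨linearIndependent_monomial hq hq4, span_monomial hq hq4⟩
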